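/- There are a constant $C$ and a function $d:\{1,2,3,\dots\}\to\{0,1,2,\dots\}$ with $d(k)\le 2^{C k\log k}$ for all $k\ge 2$ such that, for every integer $k\ge 1$, every $k$-queue graph is $(2k+1,d(k))$-choosable. In short: every $k$-queue graph is $(2k+1,2^{O(k\log k)})$-choosable. Here graphs are finite and simple. A graph $G$ is a $k$-queue graph if there are a linear ordering $v_1,\dots,v_n$ of $V(G)$ and a partition of $E(G)$ into $k$ (possibly empty) sets $E_1,\dots,E_k$ such that no $E_i$ contains two edges $v_av_b$ and $v_cv_d$ with $a<c<d<b$. A graph $G$ is $(m,d)$-choosable if, for every function $L$ assigning a set $L(v)$ of exactly $m$ colours to each vertex $v$, one can choose for each vertex $v$ a colour in $L(v)$ such that every vertex has at most $d$ neighbours with the same colour as itself. -/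

import Mathlib

universe u w

/-- The colouring `c` has defect `d`: every vertex has at most `d` neighbours of its own colour. -/
def HasDefect {V : Type*} {α : Type*} (G : SimpleGraph V) (c : V → α) (d : ℕ) : Prop :=
  ∀ v : V, {w : V | G.Adj v w ∧ c w = c v}.encard ≤ d

/-- `G` is `(m, d)`-choosable: for every assignment `L` of a set of exactly `m` colours to each
vertex there is a colouring with defect `d` that gives each vertex `v` a colour in `L v`. -/
def IsDefectiveChoosable {V : Type u} (G : SimpleGraph V) (m d : ℕ) : Prop :=
  ∀ (α : Type w) (L : V → Finset α), (∀ v, (L v).card = m) →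
    ∃ c : V → α, (∀ v, c v ∈ L v) ∧ HasDefect G c d

/-- A linear ordering `σ 0, …, σ (n - 1)` of the vertices and a partition of the edges into `k`
(possibly empty) parts, the fibres of `q`, form a queue layout of `G`: edges `σ a σ b` and
`σ c σ d` that are nested, in the sense that `a < c < d < b`, lie in different parts. -/
def IsQueueLayout {V : Type*} (G : SimpleGraph V) {n k : ℕ}
    (σ : Fin n ≃ V) (q : G.edgeSet → Fin k) : Prop :=
  ∀ (a b c d : Fin n) (hab : G.Adj (σ a) (σ b)) (hcd : G.Adj (σ c) (σ d)),
    a < c → c < d → d < b →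
      q ⟨s(σ a, σ b), G.mem_edgeSet.2 hab⟩ ≠ q ⟨s(σ c, σ d), G.mem_edgeSet.2 hcd⟩

/-- `G` is a `k`-queue graph: it has a `k`-queue layout. (Such a graph is finite.) -/
def IsQueueGraph {V : Type*} (G : SimpleGraph V) (k : ℕ) : Prop :=
  ∃ (n : ℕ) (σ : Fin n ≃ V) (q : G.edgeSet → Fin k), IsQueueLayout G σ q

/-! Induct over spanning subgraphs: delete the edges at a low-degree vertex or a single light edge,
colour the rest, then recolour at most one vertex. Such a vertex or edge always exists in a queue
graph because each subgraph has few edges relative to its non-isolated vertices: otherwise the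
small-degree vertices are independent, and double counting against the high-degree ones is
contradictory. The resulting defect `4k(2k+1)` is polynomial in `k`. -/

section DefectiveChoosability

open Finset
open scoped Classical

/-- Recolouring `v` with a colour that no neighbour of `v` has does not increase the defect. -/
theorem HasDefect.update {V α : Type*} {H H' : SimpleGraph V} {c : V → α} {d : ℕ} {v : V} {a : α}
    (hc : HasDefect H' c d) (hH : ∀ x y, x ≠ v → y ≠ v → H.Adj x y → H'.Adj x y)
    (ha : ∀ w, H.Adj v w → c w ≠ a) : HasDefect H (Function.update c v a) d := by
  intro w
  by_cases hw : w = v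
  · subst hw
    have : {u : V | H.Adj w u ∧ Function.update c w a u = Function.update c w a w} = ∅ := by
      ext u
      simp only [Set.mem_ofPred_eq, Function.update_self, Set.mem_empty_iff_false, iff_false,
        not_and]
      intro hu
      rw [Function.update_of_ne hu.ne']
      exact ha u hu
    rw [this, Set.encard_empty]
    exact zero_le
  · refine (Set.encard_le_encard ?_).trans (hc w)
    rintro u ⟨hu, hcu⟩
    rw [Function.update_of_ne hw] at hcu
    by_cases huv : u = v
    · subst huv
      rw [Function.update_self] at hcu
      exact absurd hcu.symm (ha w hu.symm)
    · rw [Function.update_of_ne huv] at hcu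
      exact ⟨hH w u hw huv hu, hcu⟩

/-- If every non-empty spanning subgraph has a non-isolated vertex of degree at most `m` or an edge
whose ends have degree at most `m + d`, then the graph is `(m + 1, d)`-choosable. -/
theorem isDefectiveChoosable_of_light_edges {V : Type u} [Fintype V] (G : SimpleGraph V) (m d : ℕ)
    (h : ∀ H ≤ G, H ≠ ⊥ → (∃ v, 0 < H.degree v ∧ H.degree v ≤ m) ∨
      ∃ x y, H.Adj x y ∧ H.degree x ≤ m + d ∧ H.degree y ≤ m + d) :
    IsDefectiveChoosable.{u, w} G (m + 1) d := by
  intro α L hL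
  suffices key : ∀ H ≤ G, ∃ c : V → α, (∀ v, c v ∈ L v) ∧ HasDefect H c d from key G le_rfl
  intro H
  induction H using WellFoundedLT.induction with
  | ind H ih =>
  intro hG
  have update_mem : ∀ {c : V → α} {v : V} {a : α}, (∀ v, c v ∈ L v) → a ∈ L v →
      ∀ w, Function.update c v a w ∈ L w := by
    intro c v a hc ha w
    by_cases hw : w = v
    · subst hw; simpa using ha
    · rw [Function.update_of_ne hw]; exact hc w
  by_cases hbot : H = ⊥
  · have hne : ∀ v, (L v).Nonempty := fun v => by
      rw [← Finset.card_pos, hL v]; exact Nat.succ_pos m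
    choose c hc using hne
    exact ⟨c, hc, fun v => by simp [hbot]⟩
  rcases h H hG hbot with ⟨v, hv0, hvm⟩ | ⟨x, y, hxy, hx, hy⟩
  · obtain ⟨u, hu⟩ := (H.degree_pos_iff_exists_adj v).1 hv0
    have hlt : H.deleteEdges {e | v ∈ e} < H :=
      lt_of_le_of_ne (H.deleteEdges_le _) fun he => by
        have := he ▸ hu
        simp [SimpleGraph.deleteEdges_adj] at this
    obtain ⟨c, hcL, hcd⟩ := ih _ hlt (hlt.le.trans hG)
    obtain ⟨a, ha, hac⟩ : ∃ a ∈ L v, a ∉ (H.neighborFinset v).image c :=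
      Finset.exists_mem_notMem_of_card_lt_card <| by
        refine Finset.card_image_le.trans_lt ?_
        rw [H.card_neighborFinset_eq_degree, hL]; omega
    refine ⟨_, update_mem hcL ha, hcd.update (v := v) (a := a) ?_ ?_⟩
    · intro p q hp hq hpq
      simp [SimpleGraph.deleteEdges_adj, hpq, hp.symm, hq.symm]
    · intro w hw hcw
      exact hac (Finset.mem_image.2 ⟨w, by simpa using hw, hcw⟩)
  · have hlt : H.deleteEdges {s(x, y)} < H :=
      lt_of_le_of_ne (H.deleteEdges_le _) fun he => by
        have := he ▸ hxy
        simp [SimpleGraph.deleteEdges_adj] at this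
    obtain ⟨c, hcL, hcd⟩ := ih _ hlt (hlt.le.trans hG)
    by_cases hgood : HasDefect H c d
    · exact ⟨c, hcL, hgood⟩
    obtain ⟨v, hv⟩ := not_forall.1 hgood
    have hvxy : v = x ∨ v = y := by
      by_contra! hne
      refine hv ((Set.encard_le_encard ?_).trans (hcd v))
      rintro u ⟨hu, hcu⟩
      refine ⟨?_, hcu⟩
      simp [SimpleGraph.deleteEdges_adj, hu, hne.1, hne.2]
    have hdeg : H.degree v ≤ m + d := by rcases hvxy with rfl | rfl <;> assumption
    have hbad : d < #{w ∈ H.neighborFinset v | c w = c v} := by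
      rw [not_le] at hv
      rw [← Nat.cast_lt (α := ℕ∞), ← Set.encard_coe_eq_coe_finsetCard]
      simpa using hv
    have hsplit := Finset.card_filter_add_card_filter_not (s := H.neighborFinset v)
      (fun w => c w = c v)
    rw [H.card_neighborFinset_eq_degree] at hsplit
    -- More than `d` of the at most `m + d` neighbours share the colour of `v`, so the others and `c
    -- v` together forbid at most `m` colours.
    obtain ⟨a, ha, hac⟩ :
        ∃ a ∈ L v, a ∉ insert (c v) ({w ∈ H.neighborFinset v | ¬ c w = c v}.image c) :=
      Finset.exists_mem_notMem_of_card_lt_card <| by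
        refine (Finset.card_insert_le _ _).trans_lt ?_
        have := Finset.card_image_le (s := {w ∈ H.neighborFinset v | ¬ c w = c v}) (f := c)
        rw [hL]; omega
    refine ⟨_, update_mem hcL ha, hcd.update (v := v) (a := a) ?_ ?_⟩
    · intro p q hp hq hpq
      rw [SimpleGraph.deleteEdges_adj]
      refine ⟨hpq, fun he => ?_⟩
      rw [Set.mem_singleton_iff, Sym2.eq_iff] at he
      rcases hvxy with rfl | rfl <;> tauto
    · intro w hw hcw
      refine hac ?_
      by_cases hwv : c w = c v
      · exact Finset.mem_insert.2 (Or.inl (hcw.symm.trans hwv))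
      · exact Finset.mem_insert_of_mem
          (Finset.mem_image.2 ⟨w, by simpa [hwv] using hw, hcw⟩)

/-- A `k`-queue graph with set `S` of non-isolated vertices has at most `2k|S|` edges, and so has
every subgraph of it. -/
theorem IsQueueLayout.card_edgeFinset_le {V : Type*} [Fintype V] {G H : SimpleGraph V} {n k : ℕ}
    {σ : Fin n ≃ V} {q : G.edgeSet → Fin k} (hq : IsQueueLayout G σ q) (hHG : H ≤ G) :
    #H.edgeFinset ≤ 2 * k * #{v | 0 < H.degree v} := by
  set S : Finset V := {v | 0 < H.degree v} with hS
  -- Ranks within `S`, not positions in the ordering, make the bound depend on `#S` alone.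
  set r : V → ℕ := fun v => #{x ∈ S | σ.symm x < σ.symm v} with hr
  have hmem : ∀ {x y}, H.Adj x y → x ∈ S := fun {x y} hxy => by
    simpa [hS] using (H.degree_pos_iff_exists_adj x).2 ⟨y, hxy⟩
  have hmono : ∀ {x y}, σ.symm x ≤ σ.symm y → r x ≤ r y := fun {x y} hxy =>
    Finset.card_le_card fun z hz => by
      simp only [Finset.mem_filter] at hz ⊢
      exact ⟨hz.1, hz.2.trans_le hxy⟩
  have hstrict : ∀ {x y}, x ∈ S → σ.symm x < σ.symm y → r x < r y := fun {x y} hx hxy =>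
    Finset.card_lt_card <| (Finset.ssubset_iff_of_subset fun z hz => by
      simp only [Finset.mem_filter] at hz ⊢
      exact ⟨hz.1, hz.2.trans hxy⟩).2 ⟨x, by simp [hx, hxy], by simp⟩
  have hlt : ∀ {x}, x ∈ S → r x < #S := fun {x} hx =>
    Finset.card_lt_card <| (Finset.ssubset_iff_of_subset (Finset.filter_subset _ _)).2
      ⟨x, hx, by simp⟩
  let f : H.edgeFinset → Fin k × ℕ := fun e =>
    (q ⟨e.1, SimpleGraph.edgeSet_mono hHG (SimpleGraph.mem_edgeFinset.1 e.2)⟩,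
      Sym2.lift ⟨fun x y => r x + r y, fun x y => add_comm _ _⟩ e.1)
  have horient : ∀ e : H.edgeFinset, ∃ a b, ∃ h : H.Adj (σ a) (σ b), a < b ∧
      e = ⟨s(σ a, σ b), SimpleGraph.mem_edgeFinset.2 h⟩ := by
    rintro ⟨e, he⟩
    induction e using Sym2.ind with
    | _ x y =>
    have hxy : H.Adj x y := by simpa using he
    rcases lt_trichotomy (σ.symm x) (σ.symm y) with h | h | h
    · exact ⟨σ.symm x, σ.symm y, by simpa using hxy, h, by simp⟩
    · exact absurd (σ.symm.injective h) hxy.ne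
    · exact ⟨σ.symm y, σ.symm x, by simpa using hxy.symm, h, by simp [Sym2.eq_swap]⟩
  -- Two distinct edges with equal rank sum are nested, so they lie in different queues.
  have hinj : Function.Injective f := by
    intro e e' hee
    obtain ⟨a, b, hab, hlt₁, rfl⟩ := horient e
    obtain ⟨a', b', hab', hlt₂, rfl⟩ := horient e'
    obtain ⟨hq', hsum⟩ := Prod.mk.inj hee
    simp only [Sym2.lift_mk] at hsum
    rcases lt_trichotomy a a' with h | h | h
    · have h1 := hstrict (hmem hab) (y := σ a') (by simpa using h)
      have h2 : b' < b := by
        by_contra! hle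
        have := hmono (x := σ b) (y := σ b') (by simpa using hle)
        omega
      exact absurd hq' (hq a b a' b' (hHG hab) (hHG hab') h hlt₂ h2)
    · subst h
      have : b = b' := by
        rcases lt_trichotomy b b' with h | h | h
        · have := hstrict (hmem hab.symm) (y := σ b') (by simpa using h)
          omega
        · exact h
        · have := hstrict (hmem hab'.symm) (y := σ b) (by simpa using h)
          omega
      subst this
      rfl
    · have h1 := hstrict (hmem hab') (y := σ a) (by simpa using h)
      have h2 : b < b' := by
        by_contra! hle
        have := hmono (x := σ b') (y := σ b) (by simpa using hle)
        omega
      exact absurd hq'.symm (hq a' b' a b (hHG hab') (hHG hab) h hlt₁ h2)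
  have hcard := Finset.card_le_card_of_injOn (s := Finset.univ)
    (t := (Finset.univ : Finset (Fin k)) ×ˢ Finset.range (2 * #S)) f (by
      intro e _
      obtain ⟨a, b, hab, -, rfl⟩ := horient e
      have h1 := hlt (hmem hab)
      have h2 := hlt (hmem hab.symm)
      simp only [f, Sym2.lift_mk, Finset.coe_product, Set.mem_prod, Finset.mem_coe,
        Finset.mem_univ, Finset.mem_range, true_and]
      omega) hinj.injOn
  simp only [Finset.card_univ, Fintype.card_coe, Finset.card_product, Fintype.card_fin,
    Finset.card_range] at hcard
  calc #H.edgeFinset ≤ k * (2 * #S) := hcard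
    _ = 2 * k * #S := by ring

/-- A non-empty graph with at most `2k` times as many edges as non-isolated vertices has a
non-isolated vertex of degree at most `2k` or an edge whose ends both have small degree. -/
theorem exists_low_degree_or_light_edge {V : Type*} [Fintype V] {H : SimpleGraph V} {k l : ℕ}
    (hE : #H.edgeFinset ≤ 2 * k * #{v | 0 < H.degree v}) (hl : 4 * k * (2 * k + 1) ≤ l)
    (hH : H ≠ ⊥) :
    (∃ v, 0 < H.degree v ∧ H.degree v ≤ 2 * k) ∨
      ∃ x y, H.Adj x y ∧ H.degree x ≤ l ∧ H.degree y ≤ l := by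
  by_contra! hcon
  obtain ⟨hlow, hlight⟩ := hcon
  set A : Finset V := {v | 0 < H.degree v ∧ H.degree v ≤ l} with hA
  set B : Finset V := {v | l < H.degree v} with hB
  have hdisj : Disjoint A B := by
    rw [Finset.disjoint_left]
    intro v hvA hvB
    simp only [hA, hB, Finset.mem_filter] at hvA hvB
    omega
  have hunion : ({v | 0 < H.degree v} : Finset V) = A ∪ B := by
    ext v
    simp only [hA, hB, Finset.mem_union, Finset.mem_filter, Finset.mem_univ, true_and]
    omega
  have hsum : ∑ v ∈ A, H.degree v + ∑ v ∈ B, H.degree v = 2 * #H.edgeFinset := by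
    rw [← Finset.sum_union hdisj, ← hunion, ← H.sum_degrees_eq_twice_card_edges]
    refine Finset.sum_subset (Finset.subset_univ _) fun v _ hv => ?_
    simpa using hv
  -- Without light edges, every edge at `A` ends in `B`.
  have hAB : ∑ v ∈ A, H.degree v ≤ ∑ v ∈ B, H.degree v := by
    calc ∑ v ∈ A, H.degree v = ∑ v ∈ A, #(B.bipartiteAbove H.Adj v) := by
          refine Finset.sum_congr rfl fun v hv => ?_
          rw [← H.card_neighborFinset_eq_degree]
          congr 1
          ext w
          simp only [SimpleGraph.mem_neighborFinset, Finset.mem_bipartiteAbove]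
          refine ⟨fun hw => ⟨?_, hw⟩, And.right⟩
          simp only [hA, hB, Finset.mem_filter, Finset.mem_univ, true_and] at hv ⊢
          exact hlight v w hw hv.2
      _ = ∑ w ∈ B, #(A.bipartiteBelow H.Adj w) :=
          Finset.sum_card_bipartiteAbove_eq_sum_card_bipartiteBelow _
      _ ≤ ∑ w ∈ B, H.degree w := by
          refine Finset.sum_le_sum fun w _ => ?_
          rw [← H.card_neighborFinset_eq_degree]
          refine Finset.card_le_card fun v hv => ?_
          rw [SimpleGraph.mem_neighborFinset]
          exact ((Finset.mem_bipartiteBelow _).1 hv).2.symm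
  have hAlow : #A * (2 * k + 1) ≤ ∑ v ∈ A, H.degree v := by
    rw [← smul_eq_mul]
    refine Finset.card_nsmul_le_sum _ _ _ fun v hv => ?_
    simp only [hA, Finset.mem_filter] at hv
    exact hlow v hv.2.1
  have hBlow : #B * (l + 1) ≤ ∑ v ∈ B, H.degree v := by
    rw [← smul_eq_mul]
    refine Finset.card_nsmul_le_sum _ _ _ fun v hv => ?_
    simpa [hB] using hv
  rw [hunion, Finset.card_union_of_disjoint hdisj] at hE
  -- `(2k+1)#A ≤ ∑_A deg ≤ #E ≤ 2k(#A + #B)`, the middle step by `hAB`.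
  have hA' : #A ≤ 2 * k * #B := by linarith
  have hB' : #B * (l + 1) ≤ #B * l := by
    calc #B * (l + 1) ≤ 2 * (2 * k * (#A + #B)) :=
          hBlow.trans ((Nat.le_add_left _ _).trans (hsum.le.trans (Nat.mul_le_mul_left 2 hE)))
      _ ≤ 2 * (2 * k * (2 * k * #B + #B)) := by gcongr
      _ = #B * (4 * k * (2 * k + 1)) := by ring
      _ ≤ #B * l := by gcongr
  have hB0 : #B = 0 := by linarith
  have hA0 : #A = 0 := by simpa [hB0] using hA'
  obtain ⟨x, y, hxy⟩ := SimpleGraph.ne_bot_iff_exists_adj.1 hH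
  have hx : x ∈ ({v | 0 < H.degree v} : Finset V) := by
    simpa using (H.degree_pos_iff_exists_adj x).2 ⟨y, hxy⟩
  rw [hunion, Finset.card_eq_zero.1 hA0, Finset.card_eq_zero.1 hB0] at hx
  simp at hx

theorem IsQueueGraph.isDefectiveChoosable {V : Type u} {G : SimpleGraph V} {k : ℕ}
    (hG : IsQueueGraph G k) :
    IsDefectiveChoosable.{u, w} G (2 * k + 1) (4 * k * (2 * k + 1)) := by
  obtain ⟨n, σ, q, hq⟩ := hG
  have : Fintype V := Fintype.ofEquiv _ σ
  exact isDefectiveChoosable_of_light_edges G (2 * k) _ fun H hH hbot =>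
    exists_low_degree_or_light_edge (hq.card_edgeFinset_le hH) (Nat.le_add_left _ _) hbot

/-- The defect is at most `2^(6k)`, and `log k ≥ 1/2` turns the exponent `6k` into `12 k log k`. -/
theorem four_mul_mul_two_mul_add_one_le_two_rpow {k : ℕ} (hk : 2 ≤ k) :
    ((4 * k * (2 * k + 1) : ℕ) : ℝ) ≤ (2 : ℝ) ^ ((12 : ℝ) * ((k : ℝ) * Real.log (k : ℝ))) := by
  have hlog : (1 / 2 : ℝ) ≤ Real.log k := by
    have h1 : Real.log 2 ≤ Real.log k := Real.log_le_log (by norm_num) (by exact_mod_cast hk)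
    linarith [Real.log_two_gt_d9]
  have hpow : 4 * k * (2 * k + 1) ≤ 2 ^ (6 * k) := by
    have h1 : k ≤ 2 ^ k := Nat.lt_two_pow_self.le
    have h2 : 4 ≤ 2 ^ k := by simpa using Nat.pow_le_pow_right (n := 2) (by norm_num) hk
    calc 4 * k * (2 * k + 1) ≤ 4 * k * (4 * k) := by gcongr; omega
      _ ≤ 2 ^ k * 2 ^ k * (2 ^ k * 2 ^ k) := by gcongr
      _ = 2 ^ (4 * k) := by ring
      _ ≤ 2 ^ (6 * k) := Nat.pow_le_pow_right (by norm_num) (by omega)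
  calc ((4 * k * (2 * k + 1) : ℕ) : ℝ) ≤ ((2 ^ (6 * k) : ℕ) : ℝ) := by exact_mod_cast hpow
    _ = (2 : ℝ) ^ ((6 * k : ℕ) : ℝ) := by rw [Real.rpow_natCast]; push_cast; rfl
    _ ≤ (2 : ℝ) ^ ((12 : ℝ) * ((k : ℝ) * Real.log (k : ℝ))) := by
      refine Real.rpow_le_rpow_of_exponent_le (by norm_num) ?_
      push_cast
      nlinarith [mul_le_mul_of_nonneg_left hlog (Nat.cast_nonneg (α := ℝ) k)]

end DefectiveChoosability

theorem mainTheorem7 :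
    ∃ (C : ℝ) (d : ℕ → ℕ),
      (∀ k : ℕ, 2 ≤ k → (d k : ℝ) ≤ (2 : ℝ) ^ (C * ((k : ℝ) * Real.log (k : ℝ)))) ∧
      ∀ (k : ℕ), 1 ≤ k → ∀ (V : Type u) (G : SimpleGraph V), IsQueueGraph G k →
        IsDefectiveChoosable.{u, w} G (2 * k + 1) (d k) :=
  ⟨12, fun k => 4 * k * (2 * k + 1), fun _ hk => four_mul_mul_two_mul_add_one_le_two_rpow hk,
    fun _ _ _ _ hG => hG.isDefectiveChoosable⟩
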